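/- Work in Markov's constructive semantics: constructive objects (words) are coded by natural numbers, mappings and sequences are algorithms (partial recursive functions given by their codes), a set (relation) is a formula with one (two) parameters, and a formula is true if it has a realizer in the sense of recursive realizability. In particular, "there exists" and "or" are understood effectively, an implication requires an algorithm turning realizers of the premise into realizers of the conclusion, and equality of objects is graphical equality (equality of codes). A topological space $T$ is a set of points, a set of basic neighbourhoods and an incidence relation "$x\in U$" between them such that every point has a basic neighbourhood, and for any basic neighbourhoods $U,V$ of a point there is a basic neighbourhood $W$ of the same point with $W\subseteq U$ and $W\subseteq V$. A point $x$ is an adherent point of a set $M$ of points if every basic neighbourhood of $x$ contains a point of $M$. A pair $\langle U;V\rangle$ of basic neighbourhoods is regular if every point $x$ of $T$ either belongs to $U$ or is not an adherent point of $V$. A directed set $D$ is a set with a reflexive and transitive relation $\le$ in which any two elements have an upper bound. A sequence $\{z_n\}_{n\in\mathbb N}$ in $D$ is cofinal if for every $\alpha\in D$ there is $N$ with $\alpha\le z_n$ for all $n\ge N$. A sequence $\{x_n\}$ in $D$ is regular with respect to $\{z_n\}$ if $z_n\le x_n$ for all $n$. A net $\{f_\alpha\}_{\alpha\in D}$ of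 points of $T$ is separable if for every $\alpha\in D$ there are an index $\beta\ge\alpha$ and a recursively enumerable set $F_\alpha\subseteq D$ such that $\alpha\le\gamma$ for all $\gamma\in F_\alpha$, and, for every $\beta'\ge\beta$, the point $f_{\beta'}$ is an adherent point of $\{\xi\in T:\exists\gamma\in F_\alpha,\ \xi=f_\gamma\}$. A point $\xi$ is a limit of a sequence (net) of points if every basic neighbourhood of $\xi$ contains all terms of the sequence from some number on (all terms $f_\beta$ with $\beta\ge\alpha$, for some $\alpha\in D$); a sequence converges if it has a limit. **Theorem.** Let $T$ be a topological space such that for every point $\xi$ and every basic neighbourhood $U$ of $\xi$ there is a basic neighbourhood $V$ of $\xi$ for which the pair $\langle U;V\rangle$ is regular. Let $\{f_\alpha\}_{\alpha\in D}$ be a separable net of points of $T$, and let $\{z_n\}_{n\in\mathbb N}$ be a non-decreasing cofinal sequence in the directed set $D$ such that, for every sequence $\{x_n\}$ in $D$ regular with respect to $\{z_n\}$, the sequence $\{f_{x_n}\}_{n\in\mathbb N}$ converges. Then the net $\{f_\alpha\}_{\alpha\in D}$ has a limit. The theorem is asserted as a constructive truth: there is a single realizer of this implication, which does not depend on the formulas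 defining $T$, $D$ and $\le$. -/

import Mathlib

/-! Constructive (Markov) semantics through recursive realizability.

Constructive objects (words) are coded by natural numbers and algorithms by the numbers of
`Nat.Partrec.Code`.  The meaning of a formula is the set of the natural numbers that solve the
constructive problem it expresses, and a formula is true if this set has an element.  A set in the
sense of constructive mathematics is a formula with one parameter, and a relation is a formula with
two parameters.  -/

namespace Constructive

/-- The result of applying the algorithm with number `e` to `x`; it may be undefined. -/
def app (e x : ℕ) : Part ℕ := (Denumerable.ofNat Nat.Partrec.Code e).eval x

/-- The meaning of a formula: the set of its realizers. -/
abbrev Prob : Type := Set ℕ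

/-- Constructive sets: `r ∈ X x` says that `r` realizes the membership of `x` in `X`. -/
abbrev CSet : Type := ℕ → Prob

/-- Constructive binary relations. -/
abbrev CRel : Type := ℕ → ℕ → Prob

/-- A condition without constructive content. -/
def atom (p : Prop) : Prob := {_r | p}

def conj (A B : Prob) : Prob := {r | r.unpair.1 ∈ A ∧ r.unpair.2 ∈ B}

def disj (A B : Prob) : Prob :=
  {r | (r.unpair.1 = 0 ∧ r.unpair.2 ∈ A) ∨ (r.unpair.1 = 1 ∧ r.unpair.2 ∈ B)}

def impl (A B : Prob) : Prob := {e | ∀ a ∈ A, ∃ b ∈ app e a, b ∈ B}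

def neg (A : Prob) : Prob := impl A (atom False)

/-- The universal quantifier over all constructive objects. -/
def all (P : ℕ → Prob) : Prob := {e | ∀ n, ∃ b ∈ app e n, b ∈ P n}

/-- The existential quantifier over all constructive objects. -/
def ex (P : ℕ → Prob) : Prob := {r | r.unpair.2 ∈ P r.unpair.1}

/-- The formula `!t ∧ P(t)`: the term `t` has a value, and the value satisfies `P`. -/
def val (t : Part ℕ) (P : ℕ → Prob) : Prob := {r | ∃ v ∈ t, r ∈ P v}

notation:35 A:36 " ∧ᵣ " B:35 => conj A B
notation:30 A:31 " ∨ᵣ " B:30 => disj A B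
notation:25 A:26 " ⇒ᵣ " B:25 => impl A B

/-- `∀ x ∈ X, P x`. -/
def allIn (X : CSet) (P : ℕ → Prob) : Prob := all fun x => X x ⇒ᵣ P x

/-- `∃ x ∈ X, P x`. -/
def exIn (X : CSet) (P : ℕ → Prob) : Prob := ex fun x => X x ∧ᵣ P x

/-- The recursively enumerable (generated) set with number `w`: the domain of the algorithm `w`. -/
def genSet (w : ℕ) : CSet := fun x => atom (app w x).Dom

section Topology

/-! `S` is the set of points, `Q` the set of basic neighbourhoods, `I x U` the incidence of the
point `x` with the basic neighbourhood `U`. -/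

/-- The axioms of a topological space given by basic neighbourhoods: each point has one, and
any two basic neighbourhoods of a point include a common basic neighbourhood of the point. -/
def isTopSpace (S Q : CSet) (I : CRel) : Prob :=
  (allIn S fun x => exIn Q fun U => I x U) ∧ᵣ
  (allIn S fun x => allIn Q fun U => allIn Q fun V => I x U ⇒ᵣ I x V ⇒ᵣ
    exIn Q fun W => I x W ∧ᵣ allIn S fun y => I y W ⇒ᵣ (I y U ∧ᵣ I y V))

/-- `x` is an adherent point of the set `M` of points. -/
def adherent (S Q : CSet) (I : CRel) (M : CSet) (x : ℕ) : Prob :=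
  allIn Q fun U => I x U ⇒ᵣ exIn S fun y => M y ∧ᵣ I y U

/-- `⟨U; V⟩` is a regular pair: each point lies in `U` or is not an adherent point of `V`. -/
def regularPair (S Q : CSet) (I : CRel) (U V : ℕ) : Prob :=
  allIn S fun x => I x U ∨ᵣ neg (adherent S Q I (fun y => I y V) x)

/-- For every point and each of its basic neighbourhoods `U` there is a basic neighbourhood `V` of
the point such that `⟨U; V⟩` is a regular pair. -/
def hasRegularPairs (S Q : CSet) (I : CRel) : Prob :=
  allIn S fun x => allIn Q fun U => I x U ⇒ᵣ
    exIn Q fun V => I x V ∧ᵣ regularPair S Q I U V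

/-- The sequence `s` converges: it has a limit among the points. -/
def seqConverges (S Q : CSet) (I : CRel) (s : ℕ → Part ℕ) : Prob :=
  exIn S fun x => allIn Q fun U => I x U ⇒ᵣ
    ex fun N => all fun n => atom (N ≤ n) ⇒ᵣ val (s n) fun y => I y U

end Topology

section Directed

/-- `D` with the relation `le` is a directed set (a preorder with upper bounds of pairs). -/
def isDirected (D : CSet) (le : CRel) : Prob :=
  (allIn D fun a => le a a) ∧ᵣ
  (allIn D fun a => allIn D fun b => allIn D fun c => le a b ⇒ᵣ le b c ⇒ᵣ le a c) ∧ᵣ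
  (allIn D fun a => allIn D fun b => exIn D fun c => le a c ∧ᵣ le b c)

/-- The algorithm `x` is a sequence of elements of `D`. -/
def isSeq (D : CSet) (x : ℕ) : Prob := all fun n => val (app x n) D

/-- The sequence `z` is non-decreasing. -/
def isNondecreasing (le : CRel) (z : ℕ) : Prob :=
  all fun m => all fun n => atom (m ≤ n) ⇒ᵣ
    val (app z m) fun a => val (app z n) fun b => le a b

/-- The sequence `z` is cofinal: it is eventually above each element of `D`. -/
def isCofinal (D : CSet) (le : CRel) (z : ℕ) : Prob :=
  allIn D fun a => ex fun N => all fun n => atom (N ≤ n) ⇒ᵣ val (app z n) fun b => le a b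

/-- The sequence `x` is regular with respect to `z`: `z_n ≤ x_n` for all `n`. -/
def isRegularSeq (le : CRel) (z x : ℕ) : Prob :=
  all fun n => val (app z n) fun a => val (app x n) fun b => le a b

end Directed

section Nets

/-- The algorithm `f` is a net of points indexed by `D`. -/
def isNet (S D : CSet) (f : ℕ) : Prob := allIn D fun a => val (app f a) S

/-- The set of the points that are (as words) equal to `f_γ` for some `γ ∈ F`. -/
def imageSet (f : ℕ) (F : CSet) : CSet := fun x =>
  exIn F fun c => val (app f c) fun y => atom (x = y)

/-- The net `f` is separable: for every `α` there are an index `β ≥ α` and a generated set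
`F ⊆ D` of indices `γ ≥ α` such that each `f_β'` with `β' ≥ β` is an adherent point of
`{f_γ : γ ∈ F}`. -/
def isSeparableNet (S Q : CSet) (I : CRel) (D : CSet) (le : CRel) (f : ℕ) : Prob :=
  allIn D fun a => exIn D fun b => le a b ∧ᵣ
    ex fun w =>
      (allIn (genSet w) D) ∧ᵣ
      (allIn (genSet w) fun c => le a c) ∧ᵣ
      (allIn D fun b' => le b b' ⇒ᵣ
        val (app f b') fun x => adherent S Q I (imageSet f (genSet w)) x)

/-- The net `f` has a limit among the points. -/
def netHasLimit (S Q : CSet) (I : CRel) (D : CSet) (le : CRel) (f : ℕ) : Prob :=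
  exIn S fun x => allIn Q fun U => I x U ⇒ᵣ
    exIn D fun a => allIn D fun b => le a b ⇒ᵣ val (app f b) fun y => I y U

end Nets

end Constructive

open Constructive

/-! Let `ξ` be a limit of `f` along `z`, and let `U` be a neighbourhood of `ξ`. Choose
neighbourhoods `V`, `W`, `X` of `ξ` with `⟨U;V⟩`, `⟨V;W⟩`, `⟨W;X⟩` regular. If `x` is regular with
respect to `z` and agrees with `z` from some term on, every limit of `f` along `x` is adherent to
`X`, so `⟨W;X⟩` can only place it in `W`. Convergence then computes from the number of `x` an `N`
with `f (x n) ∈ W` for `n ≥ N` (`ev_modulusCode`).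

Such a modulus is an algorithm on numbers of sequences, so a sequence that knows its own number can
react to it (`exists_diagonal`). It follows `z` until, at a step `m`, it sees its modulus computed
with value at most `m`. At `m` alone it tries to take an index `γ` from the generated set `F` that
separability supplies for `z m`, with `γ` decided negatively by `⟨V;W⟩`. If such a `γ` existed, the
search would find one (`ev_exceptionCode`). The sequence would be total and regular, its modulus
would put that point in `W`, and the negative decision would be contradicted.

So `⟨V;W⟩` places every `f γ` with `γ ∈ F` in `V`. Beyond the index `β` given by separability, the
points of the net are therefore adherent to `V` (`exists_mem_adherent_of_forall_decision`), and
`⟨U;V⟩` puts them in `U`. The step `m` is found whether or not the search for `γ` stops, so `β` is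
computable; the absence of exceptions is needed only to verify it. -/

namespace Constructive

open Nat.Partrec Nat.Partrec.Code Encodable Denumerable

/-! ### A small programming language on top of `Nat.Partrec.Code` -/

/-- The number that codes the list of the values of the variables. -/
def env : List ℕ → ℕ
  | [] => 0
  | a :: l => Nat.pair (env l) a

/-- The result of running the program `c` with the values `l` of the variables. -/
def ev (c : Code) (l : List ℕ) : Part ℕ := c.eval (env l)

/-- The result of running the program `c` on the number `n`. -/
def run (c : Code) (n : ℕ) : Part ℕ := c.eval n

theorem ev_eq_run (c : Code) (l : List ℕ) : ev c l = run c (env l) := rfl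

theorem ev_comp (c t : Code) (l : List ℕ) : ev (.comp c t) l = (ev t l).bind (run c) := rfl

/-- The variable with de Bruijn index `i`. -/
def var : ℕ → Code
  | 0 => .right
  | i + 1 => .comp (var i) .left

/-- Since `0` unpairs to `(0, 0)`, the empty environment behaves as an endless supply of zeros; this
is why lookups carry the default `0`. -/
theorem env_unpair (l : List ℕ) : (env l).unpair = (env l.tail, l.headD 0) := by
  cases l with
  | nil => rfl
  | cons a l => simp [env]

@[simp] theorem ev_var (i : ℕ) (l : List ℕ) : ev (var i) l = Part.some (l.getD i 0) := by
  induction i generalizing l with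
  | zero => cases l <;> simp [ev, var, eval, env]
  | succ i ih =>
    have h : ev (var (i + 1)) l = ev (var i) l.tail := by
      have h' : ev .left l = Part.some (env l.tail) := by simp [ev, eval, env_unpair]
      rw [var, ev_comp, h', Part.bind_some, ev_eq_run]
    rw [h, ih]
    cases l <;> simp

/-- The pair of two results. -/
def pr (s t : Code) : Code := .pair s t

@[simp] theorem ev_pr (s t : Code) (l : List ℕ) :
    ev (pr s t) l = (ev s l).bind fun a => (ev t l).bind fun b => Part.some (Nat.pair a b) := by
  simp [ev, pr, eval, Seq.seq, Part.bind_some_eq_map, Part.map_eq_map]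

def fs (t : Code) : Code := .comp .left t

@[simp] theorem ev_fs (t : Code) (l : List ℕ) :
    ev (fs t) l = (ev t l).bind fun a => Part.some a.unpair.1 := by
  rfl

def sn (t : Code) : Code := .comp .right t

@[simp] theorem ev_sn (t : Code) (l : List ℕ) :
    ev (sn t) l = (ev t l).bind fun a => Part.some a.unpair.2 := by
  rfl

def num (k : ℕ) : Code := .const k

@[simp] theorem ev_num (k : ℕ) (l : List ℕ) : ev (num k) l = Part.some k := by
  simp [ev, num]

theorem partrec_app {α : Type*} [Primcodable α] {f g : α → ℕ} (hf : Computable f)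
    (hg : Computable g) : Partrec fun a => app (f a) (g a) :=
  eval_part.comp ((Computable.ofNat Code).comp hf) hg

theorem exists_code_of_partrec₂ {F : ℕ → ℕ →. ℕ} (h : Partrec₂ F) :
    ∃ c : Code, ∀ a b, run c (Nat.pair a b) = F a b := by
  obtain ⟨c, hc⟩ := exists_code.1 (Partrec.nat_iff.1
    (h.comp (Computable.fst.comp Computable.unpair) (Computable.snd.comp Computable.unpair)))
  exact ⟨c, fun a b => by rw [run, hc]; simp⟩

theorem exists_universal : ∃ c : Code, ∀ a b, run c (Nat.pair a b) = app a b :=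
  exists_code_of_partrec₂ (partrec_app Computable.fst Computable.snd)

/-- Application of one result to another. -/
noncomputable def ap (s t : Code) : Code := .comp exists_universal.choose (.pair s t)

@[simp] theorem ev_ap (s t : Code) (l : List ℕ) :
    ev (ap s t) l = (ev s l).bind fun a => (ev t l).bind fun b => app a b := by
  change (ev (pr s t) l).bind (run exists_universal.choose) = _
  simp only [ev_pr, Part.bind_assoc, Part.bind_some]
  exact congrArg _ (funext fun a => congrArg _ (funext fun b => exists_universal.choose_spec a b))

/-- The algorithm `a ↦ ev c (a :: l)`. -/
def clo (c : Code) (l : List ℕ) : ℕ := encode (curry c (env l))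

@[simp] theorem app_clo (c : Code) (l : List ℕ) (a : ℕ) : app (clo c l) a = ev c (a :: l) := by
  simp [app, clo, ev, env]

/-- The s-m-n theorem: the number of a closure is computable from the environment it captures. -/
theorem exists_lam (c : Code) : ∃ d : Code, ∀ l, ev d l = Part.some (clo c l) := by
  have h : Computable fun n => encode (curry c n) :=
    Computable.encode.comp (primrec₂_curry.to_comp.comp (Computable.const c) Computable.id)
  obtain ⟨d, hd⟩ := exists_code.1 (Partrec.nat_iff.1 h.partrec)
  exact ⟨d, fun l => by simp [ev, hd, clo]⟩

/-- Abstraction of the variable with index `0`. -/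
noncomputable def lam (c : Code) : Code := (exists_lam c).choose

@[simp] theorem ev_lam (c : Code) (l : List ℕ) : ev (lam c) l = Part.some (clo c l) :=
  (exists_lam c).choose_spec l

/-- The code that computes the number of a list of results. -/
def codeEnv : List Code → Code
  | [] => .const 0
  | t :: ts => .pair (codeEnv ts) t

/-- The list of the results of a list of programs. -/
def evs : List Code → List ℕ → Part (List ℕ)
  | [], _ => Part.some []
  | t :: ts, l => (ev t l).bind fun a => (evs ts l).bind fun as => Part.some (a :: as)

@[simp] theorem evs_nil (l : List ℕ) : evs [] l = Part.some [] := rfl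

@[simp] theorem evs_cons (t : Code) (ts : List Code) (l : List ℕ) :
    evs (t :: ts) l = (ev t l).bind fun a => (evs ts l).bind fun as => Part.some (a :: as) := rfl

theorem ev_codeEnv (ts : List Code) (l : List ℕ) :
    ev (codeEnv ts) l = (evs ts l).map env := by
  induction ts with
  | nil => simp [codeEnv, env, ev]
  | cons t ts ih =>
    change ev (pr (codeEnv ts) t) l = _
    rw [ev_pr, ih]
    -- The program evaluates the tail before the head, while `evs` evaluates the head first; the two
    -- orders agree on values, so membership is compared.
    ext b
    simp only [evs_cons, Part.mem_bind_iff, Part.mem_map_iff, Part.mem_some_iff]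
    constructor
    · rintro ⟨_, ⟨x, hx, rfl⟩, y, hy, rfl⟩
      exact ⟨y :: x, ⟨y, hy, x, hx, rfl⟩, rfl⟩
    · rintro ⟨_, ⟨y, hy, x, hx, rfl⟩, rfl⟩
      exact ⟨_, ⟨x, hx, rfl⟩, y, hy, rfl⟩

/-- The program `c` run with the results of `ts` as the values of its variables. -/
def sub (c : Code) (ts : List Code) : Code := .comp c (codeEnv ts)

@[simp] theorem ev_sub (c : Code) (ts : List Code) (l : List ℕ) :
    ev (sub c ts) l = (evs ts l).bind (ev c) := by
  rw [sub, ev_comp, ev_codeEnv, Part.bind_map]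
  rfl

theorem exists_ev_max : ∃ c : Code, ∀ a b, ev c [a, b] = Part.some (max a b) := by
  have h : Partrec₂ fun p b : ℕ => Part.some (max p.unpair.2 b) :=
    (Primrec.nat_max.to_comp.comp (Computable.snd.comp (Computable.unpair.comp Computable.fst))
      Computable.snd).partrec
  obtain ⟨c, hc⟩ := exists_code_of_partrec₂ h
  exact ⟨c, fun a b => by simp [ev_eq_run, env, hc, max_comm]⟩

/-! ### Unbounded search and a self-referential sequence -/

theorem partrec_rfind {α : Type*} [Primcodable α] {t : α → ℕ → Bool} (h : Computable₂ t) :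
    Partrec fun a => Nat.rfind (t a : ℕ →. Bool) :=
  Partrec.rfind h.partrec.to₂

theorem exists_mem_rfind {t : ℕ → Bool} (h : ∃ k, t k = true) :
    ∃ m ∈ Nat.rfind (t : ℕ →. Bool), t m = true ∧ ∀ k < m, t k = false := by
  obtain ⟨k, hk⟩ := h
  obtain ⟨m, hm, -⟩ := Nat.rfind_min' hk
  refine ⟨m, hm, ?_, fun k hkm => ?_⟩
  · simpa using Nat.rfind_spec hm
  · simpa using Nat.rfind_min hm hkm

/-- An algorithm that finds an argument at which the given algorithm has the value `1`. -/
theorem exists_search : ∃ c : Code, ∀ q, (∃ x, 1 ∈ app q x) → ∃ x ∈ ev c [q], 1 ∈ app q x := by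
  -- Dovetailing: `k` codes a step bound together with an argument. The default `0` keeps an
  -- unfinished computation from passing for the value `1`.
  let t : ℕ → ℕ → Bool := fun q k =>
    decide ((evaln k.unpair.1 (ofNat Code q) k.unpair.2).getD 0 = 1)
  have ht : Computable₂ t := by
    have h1 : Primrec fun p : ℕ × ℕ =>
        (evaln p.2.unpair.1 (ofNat Code p.1) p.2.unpair.2).getD 0 :=
      Primrec.option_getD.comp (primrec_evaln.comp (Primrec.pair (Primrec.pair
        (Primrec.fst.comp (Primrec.unpair.comp Primrec.snd))
        ((Primrec.ofNat Code).comp Primrec.fst))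
        (Primrec.snd.comp (Primrec.unpair.comp Primrec.snd)))) (Primrec.const 0)
    exact (Primrec.eq.decide.comp h1 (Primrec.const 1)).to_comp
  have hF : Partrec₂ fun _ q : ℕ =>
      (Nat.rfind (t q : ℕ →. Bool)).map fun k => k.unpair.2 := by
    have h2 : Computable₂ fun p : ℕ × ℕ => t p.2 :=
      ht.comp (Computable.snd.comp Computable.fst) Computable.snd
    exact Partrec.map (partrec_rfind h2)
      (Computable.snd.comp (Computable.unpair.comp Computable.snd)).to₂
  obtain ⟨c, hc⟩ := exists_code_of_partrec₂ hF
  refine ⟨c, fun q ⟨x, hx⟩ => ?_⟩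
  obtain ⟨k, hk⟩ := evaln_complete.1 hx
  obtain ⟨m, hm, h, -⟩ := exists_mem_rfind (t := t q)
    ⟨Nat.pair k x, by simp [t, Option.mem_def.1 hk]⟩
  refine ⟨m.unpair.2, ?_, ?_⟩
  · simp only [ev_eq_run, env, hc]
    exact Part.mem_map _ hm
  · simp only [t, decide_eq_true_eq] at h
    cases h' : evaln m.unpair.1 (ofNat Code q) m.unpair.2 with
    | none => simp [h'] at h
    | some v =>
      simp only [h', Option.getD_some] at h
      exact evaln_sound (by rw [h', h]; rfl)

/-- The computation of `app r s` stops within `n` steps with a result that is at most `n`. -/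
@[irreducible] def haltsBelow (r s n : ℕ) : Bool :=
  -- The default `n + 1` makes an unfinished computation fail the test.
  decide ((evaln n (ofNat Code r) s).getD (n + 1) ≤ n)

theorem haltsBelow_iff {r s n : ℕ} :
    haltsBelow r s n = true ↔ ∃ m ∈ evaln n (ofNat Code r) s, m ≤ n := by
  cases h : evaln n (ofNat Code r) s <;> simp [haltsBelow, h]

/-- By monotonicity, holding at `n` but not at `n - 1` singles out the first successful step. -/
theorem haltsBelow_mono {r s n k : ℕ} (hnk : n ≤ k) (h : haltsBelow r s n = true) :
    haltsBelow r s k = true := by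
  obtain ⟨m, hm, hmn⟩ := haltsBelow_iff.1 h
  exact haltsBelow_iff.2 ⟨m, evaln_mono hnk hm, hmn.trans hnk⟩

theorem computable_haltsBelow {α : Type*} [Primcodable α] {f g h : α → ℕ} (hf : Computable f)
    (hg : Computable g) (hh : Computable h) : Computable fun a => haltsBelow (f a) (g a) (h a) := by
  have h1 : Computable fun a => ((h a, ofNat Code (f a)), g a) :=
    (hh.pair ((Computable.ofNat Code).comp hf)).pair hg
  have h2 : Computable fun a => evaln (h a) (ofNat Code (f a)) (g a) :=
    primrec_evaln.to_comp.comp h1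
  have h3 : Computable fun a => (evaln (h a) (ofNat Code (f a)) (g a)).getD (h a + 1) :=
    Primrec.option_getD.to_comp.comp h2 (Computable.succ.comp hh)
  unfold haltsBelow
  exact Primrec.nat_le.decide.to_comp.comp h3 hh

/-- The sequence with parameters `p.unpair.1` that is computed by `c`, in terms of its own number. -/
def selfStep (c : Code) (p : ℕ) : Part ℕ :=
  bif haltsBelow p.unpair.1.unpair.1.unpair.2 (encode (curry c p.unpair.1)) p.unpair.2 &&
    !haltsBelow p.unpair.1.unpair.1.unpair.2 (encode (curry c p.unpair.1)) (p.unpair.2 - 1)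
  then app p.unpair.1.unpair.2 p.unpair.2 else app p.unpair.1.unpair.1.unpair.1 p.unpair.2

theorem partrec_selfStep : Partrec₂ selfStep := by
  have ha : Computable fun p : Code × ℕ => p.2.unpair.1 :=
    Computable.fst.comp (Computable.unpair.comp Computable.snd)
  have hn : Computable fun p : Code × ℕ => p.2.unpair.2 :=
    Computable.snd.comp (Computable.unpair.comp Computable.snd)
  have hs : Computable fun p : Code × ℕ => encode (curry p.1 p.2.unpair.1) :=
    Computable.encode.comp (primrec₂_curry.to_comp.comp Computable.fst ha)
  have ha1 : Computable fun p : Code × ℕ => p.2.unpair.1.unpair.1 :=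
    Computable.fst.comp (Computable.unpair.comp ha)
  have hr : Computable fun p : Code × ℕ => p.2.unpair.1.unpair.1.unpair.2 :=
    Computable.snd.comp (Computable.unpair.comp ha1)
  have hz : Computable fun p : Code × ℕ => p.2.unpair.1.unpair.1.unpair.1 :=
    Computable.fst.comp (Computable.unpair.comp ha1)
  have hb : Computable fun p : Code × ℕ => p.2.unpair.1.unpair.2 :=
    Computable.snd.comp (Computable.unpair.comp ha)
  have ht : Computable fun p : Code × ℕ => haltsBelow p.2.unpair.1.unpair.1.unpair.2
      (encode (curry p.1 p.2.unpair.1)) p.2.unpair.2 :=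
    computable_haltsBelow hr hs hn
  have ht' : Computable fun p : Code × ℕ => haltsBelow p.2.unpair.1.unpair.1.unpair.2
      (encode (curry p.1 p.2.unpair.1)) (p.2.unpair.2 - 1) :=
    computable_haltsBelow hr hs (Primrec.pred.to_comp.comp hn)
  have hc : Computable fun p : Code × ℕ => haltsBelow p.2.unpair.1.unpair.1.unpair.2
      (encode (curry p.1 p.2.unpair.1)) p.2.unpair.2 && !haltsBelow p.2.unpair.1.unpair.1.unpair.2
      (encode (curry p.1 p.2.unpair.1)) (p.2.unpair.2 - 1) :=
    Primrec.and.to_comp.comp ht (Primrec.not.to_comp.comp ht')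
  have h1 : Partrec fun p : Code × ℕ => app p.2.unpair.1.unpair.2 p.2.unpair.2 :=
    partrec_app hb hn
  have h2 : Partrec fun p : Code × ℕ => app p.2.unpair.1.unpair.1.unpair.1 p.2.unpair.2 :=
    partrec_app hz hn
  exact Partrec.cond hc h1 h2

/-- A program that defines, for the parameters `z`, `r` and `b`, a sequence that depends on its own
number. -/
theorem exists_selfReferential : ∃ c : Code, ∀ z r b n s,
    s = encode (curry c (Nat.pair (Nat.pair z r) b)) →
    app s n = bif haltsBelow r s n && !haltsBelow r s (n - 1) then app b n else app z n := by
  -- Kleene's second recursion theorem gives the program access to its own code.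
  obtain ⟨c, hc⟩ := fixed_point₂ partrec_selfStep
  refine ⟨c, fun z r b n s h => ?_⟩
  have h1 : app s n = selfStep c (Nat.pair (Nat.pair (Nat.pair z r) b) n) := by
    rw [app, h, ofNat_encode, eval_curry, hc]
  rw [h1, selfStep]
  simp only [Nat.unpair_pair, h]

/-- For algorithms `z`, `r`, `b`, a sequence `s` that knows its own number and follows `z` except
at the first step `m` at which it has seen `r` stop on `s` with a result that is at most `m`; there
its value is `b m`. -/
theorem exists_diagonal : ∃ c : Code, ∀ z r b,
    (∀ s, (∀ n, app s n = app z n) → (app r s).Dom) →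
    ∃ m ∈ ev c [z, r, b], ∃ s, ∃ k ∈ app r s, k ≤ m ∧
      ∀ n, app s n = if n = m then app b m else app z n := by
  obtain ⟨c, hc⟩ := exists_selfReferential
  have hF : Partrec₂ fun a b : ℕ =>
      Nat.rfind ((fun n => haltsBelow a.unpair.2 (encode (curry c (Nat.pair a b))) n : ℕ → Bool) :
        ℕ →. Bool) := by
    have h1 : Computable fun p : (ℕ × ℕ) × ℕ => p.1.1.unpair.2 :=
      Computable.snd.comp (Computable.unpair.comp (Computable.fst.comp Computable.fst))
    have h2 : Computable fun p : (ℕ × ℕ) × ℕ => encode (curry c (Nat.pair p.1.1 p.1.2)) :=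
      Computable.encode.comp (primrec₂_curry.to_comp.comp (Computable.const c)
        (Primrec₂.natPair.to_comp.comp (Computable.fst.comp Computable.fst)
          (Computable.snd.comp Computable.fst)))
    have h3 : Computable fun p : (ℕ × ℕ) × ℕ =>
        haltsBelow p.1.1.unpair.2 (encode (curry c (Nat.pair p.1.1 p.1.2))) p.2 :=
      computable_haltsBelow h1 h2 Computable.snd
    exact partrec_rfind (t := fun p : ℕ × ℕ => fun n =>
      haltsBelow p.1.unpair.2 (encode (curry c (Nat.pair p.1 p.2))) n) h3
  obtain ⟨d, hd⟩ := exists_code_of_partrec₂ hF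
  refine ⟨.comp d (pr (pr (var 0) (var 1)) (var 2)), fun z r b h => ?_⟩
  obtain ⟨s, hs⟩ : ∃ s, s = encode (curry c (Nat.pair (Nat.pair z r) b)) := ⟨_, rfl⟩
  have hev : ev (.comp d (pr (pr (var 0) (var 1)) (var 2))) [z, r, b] =
      Nat.rfind ((fun n => haltsBelow r s n : ℕ → Bool) : ℕ →. Bool) := by
    rw [ev_comp]
    simp only [ev_pr, ev_var, Part.bind_some, List.getD_cons_zero, List.getD_cons_succ, hd,
      Nat.unpair_pair, hs]
  have hs_app := fun n => hc z r b n s hs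
  have hex : ∃ n, haltsBelow r s n = true := by
    -- If the test never succeeds, `s` agrees with `z` everywhere, so `r` stops on `s`; a large
    -- enough bound then makes the test succeed.
    by_contra! hno
    obtain ⟨v, hv⟩ := Part.dom_iff_mem.1 (h s fun n => by simp [hs_app, hno])
    obtain ⟨k, hk⟩ := evaln_complete.1 hv
    exact hno (max k v) (haltsBelow_iff.2 ⟨v, evaln_mono (le_max_left _ _) hk, le_max_right _ _⟩)
  obtain ⟨m, hm, hmt, hmin⟩ := exists_mem_rfind hex
  obtain ⟨k, hk, hkm⟩ := haltsBelow_iff.1 hmt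
  refine ⟨m, hev ▸ hm, s, k, evaln_sound hk, hkm, fun n => ?_⟩
  -- With bound `0` nothing halts. This matters because `0 - 1 = 0` would make the test for a first
  -- success fail at `0`.
  have hm0 : m ≠ 0 := by
    rintro rfl
    simp [evaln] at hk
  rw [hs_app]
  rcases lt_trichotomy n m with hlt | rfl | hgt
  · simp [hmin n hlt, hlt.ne]
  · simp [hmt, hmin (n - 1) (by omega)]
  · simp [haltsBelow_mono (by omega : m ≤ n - 1) hmt, hgt.ne']

/-! ### Using and constructing realizers -/

theorem impl_elim {A B : Prob} {e a : ℕ} (he : e ∈ impl A B) (ha : a ∈ A) :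
    ∃ b, app e a = Part.some b ∧ b ∈ B := by
  obtain ⟨b, hb, h⟩ := he a ha
  exact ⟨b, Part.eq_some_iff.2 hb, h⟩

theorem all_elim {P : ℕ → Prob} {e : ℕ} (he : e ∈ all P) (n : ℕ) :
    ∃ b, app e n = Part.some b ∧ b ∈ P n := by
  obtain ⟨b, hb, h⟩ := he n
  exact ⟨b, Part.eq_some_iff.2 hb, h⟩

theorem allIn_elim {X : CSet} {P : ℕ → Prob} {e x a : ℕ} (he : e ∈ allIn X P) (ha : a ∈ X x) :
    ∃ g b, app e x = Part.some g ∧ app g a = Part.some b ∧ b ∈ P x := by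
  obtain ⟨g, hg, h⟩ := all_elim he x
  obtain ⟨b, hb, h'⟩ := impl_elim h ha
  exact ⟨g, b, hg, hb, h'⟩

theorem val_elim {t : Part ℕ} {P : ℕ → Prob} {r : ℕ} (h : r ∈ val t P) :
    ∃ v, t = Part.some v ∧ r ∈ P v := by
  obtain ⟨v, hv, h⟩ := h
  exact ⟨v, Part.eq_some_iff.2 hv, h⟩

theorem val_some {v : ℕ} {P : ℕ → Prob} {r : ℕ} : r ∈ val (Part.some v) P ↔ r ∈ P v := by
  simp [val]

theorem clo_mem_impl {A B : Prob} {c : Code} {l : List ℕ}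
    (h : ∀ a ∈ A, ∃ b, ev c (a :: l) = Part.some b ∧ b ∈ B) : clo c l ∈ impl A B := by
  intro a ha
  obtain ⟨b, hb, h⟩ := h a ha
  exact ⟨b, by simp [hb], h⟩

theorem clo_mem_all {P : ℕ → Prob} {c : Code} {l : List ℕ}
    (h : ∀ n, ∃ b, ev c (n :: l) = Part.some b ∧ b ∈ P n) : clo c l ∈ all P := by
  intro n
  obtain ⟨b, hb, h⟩ := h n
  exact ⟨b, by simp [hb], h⟩

/-- The body sees the membership realizer as variable `0` and the element as variable `1`. -/
theorem clo_mem_allIn {X : CSet} {P : ℕ → Prob} {c : Code} {l : List ℕ}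
    (h : ∀ x, ∀ a ∈ X x, ∃ b, ev c (a :: x :: l) = Part.some b ∧ b ∈ P x) :
    clo (lam c) l ∈ allIn X P :=
  clo_mem_all fun x => ⟨clo c (x :: l), by simp, clo_mem_impl (h x)⟩

theorem pair_mem_conj {A B : Prob} {a b : ℕ} (ha : a ∈ A) (hb : b ∈ B) :
    Nat.pair a b ∈ conj A B := by
  simpa [conj] using And.intro ha hb

theorem pair_mem_ex {P : ℕ → Prob} {x a : ℕ} (h : a ∈ P x) : Nat.pair x a ∈ ex P := by
  simpa [ex] using h

theorem pair_mem_exIn {X : CSet} {P : ℕ → Prob} {x a b : ℕ} (ha : a ∈ X x) (hb : b ∈ P x) :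
    Nat.pair x (Nat.pair a b) ∈ exIn X P :=
  pair_mem_ex (pair_mem_conj ha hb)

theorem ex_elim {P : ℕ → Prob} {r : ℕ} (h : r ∈ ex P) : ∃ x a, r = Nat.pair x a ∧ a ∈ P x :=
  ⟨_, _, (Nat.pair_unpair r).symm, h⟩

theorem conj_elim {A B : Prob} {r : ℕ} (h : r ∈ conj A B) :
    ∃ a b, r = Nat.pair a b ∧ a ∈ A ∧ b ∈ B :=
  ⟨_, _, (Nat.pair_unpair r).symm, h⟩

theorem exIn_elim {X : CSet} {P : ℕ → Prob} {r : ℕ} (h : r ∈ exIn X P) :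
    ∃ x a b, r = Nat.pair x (Nat.pair a b) ∧ a ∈ X x ∧ b ∈ P x :=
  ⟨_, r.unpair.2.unpair.1, r.unpair.2.unpair.2, by simp, h.1, h.2⟩

theorem notMem_of_mem_neg {A : Prob} {e a : ℕ} (he : e ∈ neg A) : a ∉ A := fun ha => by
  obtain ⟨_, -, h⟩ := impl_elim he ha
  exact h

/-! ### Adherent points -/

section Adherent

variable {S Q : CSet} {I : CRel}

/-- The realizers of the statement that the point `x` is a limit of the sequence `s`. -/
def isLimit (Q : CSet) (I : CRel) (s : ℕ → Part ℕ) (x : ℕ) : Prob :=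
  allIn Q fun U => I x U ⇒ᵣ ex fun N => all fun n => atom (N ≤ n) ⇒ᵣ val (s n) fun y => I y U

/-- A realizer of a limit gives the index from which on the terms lie in a neighbourhood. -/
theorem isLimit_elim {s : ℕ → Part ℕ} {x U e q i : ℕ} (he : e ∈ isLimit Q I s x) (hq : q ∈ Q U)
    (hi : i ∈ I x U) :
    ∃ g h N j, app e U = Part.some g ∧ app g q = Part.some h ∧
      app h i = Part.some (Nat.pair N j) ∧
      ∀ n, N ≤ n → ∃ j' k y, app j n = Part.some j' ∧ app j' 0 = Part.some k ∧
        s n = Part.some y ∧ k ∈ I y U := by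
  obtain ⟨g, h, hg, hh, h1⟩ := allIn_elim he hq
  obtain ⟨r, hr, h2⟩ := impl_elim h1 hi
  obtain ⟨N, j, rfl, h3⟩ := ex_elim h2
  refine ⟨g, h, N, j, hg, hh, hr, fun n hn => ?_⟩
  obtain ⟨j', hj', h4⟩ := all_elim h3 n
  obtain ⟨k, hk, h5⟩ := impl_elim h4 (a := 0) hn
  obtain ⟨y, hy, h6⟩ := val_elim h5
  exact ⟨j', k, y, hj', hk, hy, h6⟩

/-- The point itself serves as witness in each of its neighbourhoods. -/
theorem exists_mem_adherent_of_mem {V x sx i : ℕ} (hx : sx ∈ S x) (hi : i ∈ I x V) :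
    ∃ a, a ∈ adherent S Q I (fun y => I y V) x := by
  refine ⟨clo (lam (lam (pr (var 3) (pr (var 4) (pr (var 5) (var 0)))))) [x, sx, i],
    clo_mem_allIn fun U q _ => ⟨clo _ _, by simp; rfl, clo_mem_impl fun k hk => ?_⟩⟩
  exact ⟨Nat.pair x (Nat.pair sx (Nat.pair i k)), by simp,
    pair_mem_exIn hx (pair_mem_conj hi hk)⟩

/-- A limit of a sequence that agrees from some term on with a sequence of points that lies in `V`
from some term on is an adherent point of `V`. -/
theorem exists_mem_adherent_of_isLimit {s t : ℕ → Part ℕ} {x x' V q i e e' g K : ℕ}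
    {y sy : ℕ → ℕ} (he : e ∈ isLimit Q I s x) (hq : q ∈ Q V) (hi : i ∈ I x V)
    (hg : ∀ n, app g n = Part.some (Nat.pair (y n) (sy n))) (hsy : ∀ n, sy n ∈ S (y n))
    (hs : ∀ n, s n = Part.some (y n)) (ht : ∀ n, K ≤ n → t n = Part.some (y n))
    (he' : e' ∈ isLimit Q I t x') :
    ∃ a, a ∈ adherent S Q I (fun y => I y V) x' := by
  obtain ⟨-, -, N, j, -, -, -, h⟩ := isLimit_elim he hq hi
  obtain ⟨m, hm⟩ := exists_ev_max
  let r : Code := ap (ap (ap (var 6) (var 2)) (var 1)) (var 0)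
  -- At the maximum of `N'`, `N` and `K` the two sequences agree, and the common term lies both in
  -- `V` and in the given neighbourhood of `x'`.
  let n : Code := sub m [fs r, var 5]
  let b : Code := pr (fs (ap (var 3) n)) (pr (sn (ap (var 3) n))
    (pr (ap (ap (var 4) n) (num 0)) (ap (ap (sn r) n) (num 0))))
  refine ⟨clo (lam (lam b)) [g, j, max N K, e'],
    clo_mem_allIn fun U q' hq' => ⟨clo b _, by simp; rfl, clo_mem_impl fun k hk => ?_⟩⟩
  obtain ⟨g1, g2, N', j', h1, h2, h3, h'⟩ := isLimit_elim he' hq' hk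
  have hr : ev r [k, q', U, g, j, max N K, e'] = Part.some (Nat.pair N' j') := by
    simp [r, h1, h2, h3]
  have hn : ev n [k, q', U, g, j, max N K, e'] = Part.some (max N' (max N K)) := by
    simp [n, hr, hm]
  obtain ⟨j1, k1, y1, hj1, hk1, hy1, hV⟩ := h (max N' (max N K)) (by simp)
  obtain ⟨j2, k2, y2, hj2, hk2, hy2, hU⟩ := h' (max N' (max N K)) (by simp)
  rw [hs, Part.some_inj] at hy1
  rw [ht _ (by simp), Part.some_inj] at hy2
  subst hy1 hy2
  exact ⟨Nat.pair _ (Nat.pair _ (Nat.pair k1 k2)), by simp [b, hn, hg, hj1, hk1, hr, hj2, hk2],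
    pair_mem_exIn (hsy _) (pair_mem_conj hV hU)⟩

/-- A regular pair `⟨U; V⟩` decides, for each point, whether it lies in `U`; the alternative is
only possible for a point that is not an adherent point of `V`. -/
theorem regularPair_elim {U V d x a : ℕ} (hd : d ∈ regularPair S Q I U V) (ha : a ∈ S x) :
    ∃ g o v, app d x = Part.some g ∧ app g a = Part.some (Nat.pair o v) ∧
      ((o = 0 ∧ v ∈ I x U) ∨ (o = 1 ∧ ∀ b, b ∉ adherent S Q I (fun y => I y V) x)) := by
  obtain ⟨g, r, hg, hr, h⟩ := allIn_elim hd ha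
  refine ⟨g, r.unpair.1, r.unpair.2, hg, by simpa using hr, ?_⟩
  exact h.imp id fun h => ⟨h.1, fun b => notMem_of_mem_neg h.2⟩

end Adherent

/-! ### The modulus of convergence of a sequence of indices -/

/-- Variables: sequence, realizer of `V ∈ Q`, `V`, regular pair, convergence of sequences. -/
noncomputable def convergenceCode : Code :=
  ap (ap (ap (var 4) (lam (fs (ap (var 1) (var 0))))) (lam (fs (sn (ap (var 1) (var 0))))))
    (lam (sn (sn (ap (var 1) (var 0)))))

/-- Variables: as for `convergenceCode`. -/
noncomputable def modulusCode : Code :=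
  fs (ap (ap (ap (sn (sn convergenceCode)) (var 2)) (var 1))
    (sn (ap (ap (var 3) (fs convergenceCode)) (fs (sn convergenceCode)))))

/-- The limit supplied for the sequence is adherent to `W`, so the regular pair must place it in
`V`, and the realizer of the limit applied to `V` yields `N`. Adherence only excludes the negative
alternative, so mere existence of a realizer suffices in `hadh`. -/
theorem ev_modulusCode {S Q : CSet} {I : CRel} {D : CSet} {le : CRel}
    {f z cv V W q d s : ℕ} {x dx lx : ℕ → ℕ}
    (hcv : cv ∈ all fun x => isSeq D x ⇒ᵣ isRegularSeq le z x ⇒ᵣ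
      seqConverges S Q I fun n => (app x n).bind fun a => app f a)
    (hq : q ∈ Q V) (hd : d ∈ regularPair S Q I V W)
    (hs : ∀ n, app s n = Part.some (Nat.pair (x n) (Nat.pair (dx n) (lx n))))
    (hdx : ∀ n, dx n ∈ D (x n)) (hlx : ∀ n, lx n ∈ val (app z n) fun a => le a (x n))
    (hadh : ∀ y e, e ∈ isLimit Q I (fun n => app f (x n)) y →
      ∃ a, a ∈ adherent S Q I (fun y => I y W) y) :
    ∃ N, ev modulusCode [s, q, V, d, cv] = Part.some N ∧
      ∀ n, N ≤ n → ∃ y i, app f (x n) = Part.some y ∧ i ∈ I y V := by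
  obtain ⟨xs, hxs⟩ : ∃ xs, xs = clo (fs (ap (var 1) (var 0))) [s, q, V, d, cv] := ⟨_, rfl⟩
  obtain ⟨as, has⟩ : ∃ as, as = clo (fs (sn (ap (var 1) (var 0)))) [s, q, V, d, cv] := ⟨_, rfl⟩
  obtain ⟨rs, hrs⟩ : ∃ rs, rs = clo (sn (sn (ap (var 1) (var 0)))) [s, q, V, d, cv] := ⟨_, rfl⟩
  have hx : ∀ n, app xs n = Part.some (x n) := fun n => by simp [hxs, hs]
  have h1 : as ∈ isSeq D xs := by
    rw [has]
    exact clo_mem_all fun n => ⟨dx n, by simp [hs], by rw [hx, val_some]; exact hdx n⟩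
  have h2 : rs ∈ isRegularSeq le z xs := by
    rw [hrs]
    refine clo_mem_all fun n => ⟨lx n, by simp [hs], ?_⟩
    obtain ⟨a, ha, hle⟩ := hlx n
    exact ⟨a, ha, by rwa [hx, val_some]⟩
  obtain ⟨g1, hg1, h3⟩ := all_elim hcv xs
  obtain ⟨g2, hg2, h4⟩ := impl_elim h3 h1
  obtain ⟨r, hr, h5⟩ := impl_elim h4 h2
  obtain ⟨y, sy, e, rfl, hsy, he⟩ := exIn_elim h5
  have he' : e ∈ isLimit Q I (fun n => app f (x n)) y := by
    simp only [hx, Part.bind_some] at he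
    exact he
  obtain ⟨b, hb⟩ := hadh y e he'
  obtain ⟨g3, o, v, hg3, hv, h6⟩ := regularPair_elim hd hsy
  have h7 : v ∈ I y V := by
    rcases h6 with h6 | h6
    · exact h6.2
    · exact absurd hb (h6.2 b)
  obtain ⟨g4, g5, N, j, hg4, hg5, hN, h8⟩ := isLimit_elim he' hq h7
  have hc : ev convergenceCode [s, q, V, d, cv] = Part.some (Nat.pair y (Nat.pair sy e)) := by
    simp [convergenceCode, ← hxs, ← has, ← hrs, hg1, hg2, hr]
  refine ⟨N, by simp [modulusCode, hc, hg3, hv, hg4, hg5, hN], fun n hn => ?_⟩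
  obtain ⟨_, k, y, -, -, hy, hk⟩ := h8 n hn
  exact ⟨y, k, hy, hk⟩

/-! ### Search for an index that is decided negatively by a regular pair -/

/-- Variables: `γ`, generated set, its inclusion in `D`, net realizer, net, regular pair. -/
noncomputable def decisionCode : Code :=
  ap (ap (var 5) (ap (var 4) (var 0)))
    (ap (ap (var 3) (var 0)) (ap (ap (var 2) (var 0)) (num 0)))

/-- The result of running `w` on the index is discarded; running it makes the test undefined outside
the generated set, so a successful search returns a member. -/
noncomputable def decisionTestCode : Code := sn (pr (ap (var 1) (var 0)) (fs decisionCode))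

noncomputable def searchCode : Code := exists_search.choose

/-- Variables: `n`, regular pair, net, net realizer, separability, sequence realizer, sequence. -/
noncomputable def separationCode : Code :=
  ap (ap (var 4) (ap (var 6) (var 0))) (ap (var 5) (var 0))

noncomputable def exceptionCode : Code :=
  sub (pr (var 0) (pr (ap (ap (var 1) (var 0)) (num 0)) (ap (ap (var 2) (var 0)) (num 0))))
    [sub searchCode [sub (lam decisionTestCode)
      [fs (sn (sn (sn separationCode))), fs (sn (sn (sn (sn separationCode)))), var 3, var 2,
        var 1]],
    fs (sn (sn (sn (sn separationCode)))), fs (sn (sn (sn (sn (sn separationCode)))))]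

/-- The decision of a regular pair about the point with index `γ` in a generated subset of `D`. -/
theorem ev_decisionCode {S Q : CSet} {I : CRel} {D : CSet}
    {f nt w gd V W d γ : ℕ} (hnt : nt ∈ isNet S D f) (hgd : gd ∈ allIn (genSet w) D)
    (hd : d ∈ regularPair S Q I V W) (hγ : (app w γ).Dom) :
    ∃ g a y sy o v, app gd γ = Part.some g ∧ app g 0 = Part.some a ∧ a ∈ D γ ∧
      app f γ = Part.some y ∧ sy ∈ S y ∧
      ev decisionCode [γ, w, gd, nt, f, d] = Part.some (Nat.pair o v) ∧
      ((o = 0 ∧ v ∈ I y V) ∨ (o = 1 ∧ ∀ b, b ∉ adherent S Q I (fun y => I y W) y)) := by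
  obtain ⟨g, a, hg, ha, haD⟩ := allIn_elim hgd (x := γ) (a := 0) hγ
  obtain ⟨g', sy, hg', hsy, h1⟩ := allIn_elim hnt haD
  obtain ⟨y, hy, hyS⟩ := val_elim h1
  obtain ⟨g'', o, v, hg'', hv, h⟩ := regularPair_elim hd hyS
  exact ⟨g, a, y, sy, o, v, hg, ha, haD, hy, hyS,
    by simp [decisionCode, hg, ha, hg', hsy, hy, hg'', hv], h⟩

/-- The given `γ` only guarantees that the search stops; the index found may be another one. It
comes with the realizers needed to insert it into a regular sequence at place `n`. -/
theorem ev_exceptionCode {S Q : CSet} {I : CRel} {D : CSet} {le : CRel}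
    {f nt sp sz z n a da g b db lb w gd gl ad V W d γ v : ℕ} (hnt : nt ∈ isNet S D f)
    (hz : app z n = Part.some a) (hsz : app sz n = Part.some da)
    (hsp : app sp a = Part.some g)
    (hg : app g da = Part.some (Nat.pair b (Nat.pair db (Nat.pair lb
      (Nat.pair w (Nat.pair gd (Nat.pair gl ad)))))))
    (hgd : gd ∈ allIn (genSet w) D) (hgl : gl ∈ allIn (genSet w) fun c => le a c)
    (hd : d ∈ regularPair S Q I V W) (hγ : (app w γ).Dom)
    (hv : ev decisionCode [γ, w, gd, nt, f, d] = Part.some (Nat.pair 1 v)) :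
    ∃ c dc lc y sy, ev exceptionCode [n, d, f, nt, sp, sz, z] =
        Part.some (Nat.pair c (Nat.pair dc lc)) ∧
      dc ∈ D c ∧ lc ∈ le a c ∧ app f c = Part.some y ∧ sy ∈ S y ∧
      ∀ b, b ∉ adherent S Q I (fun y => I y W) y := by
  have hsep : ev separationCode [n, d, f, nt, sp, sz, z] = Part.some (Nat.pair b (Nat.pair db
      (Nat.pair lb (Nat.pair w (Nat.pair gd (Nat.pair gl ad)))))) := by
    simp [separationCode, hz, hsz, hsp, hg]
  obtain ⟨q, hq⟩ : ∃ q, q = clo decisionTestCode [w, gd, nt, f, d] := ⟨_, rfl⟩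
  have hqv : ∀ c, app q c = (app w c).bind fun _ =>
      (ev decisionCode [c, w, gd, nt, f, d]).bind fun r => Part.some r.unpair.1 := fun c => by
    simp [hq, decisionTestCode, Part.bind_assoc]
  have hex : ∃ c, 1 ∈ app q c := by
    obtain ⟨u, hu⟩ := Part.dom_iff_mem.1 hγ
    exact ⟨γ, by simp [hqv, Part.eq_some_iff.2 hu, hv]⟩
  obtain ⟨c, hc, hc1⟩ := exists_search.choose_spec q hex
  rw [hqv] at hc1
  obtain ⟨u, hu, hc1⟩ := Part.mem_bind_iff.1 hc1
  have hcw : (app w c).Dom := Part.dom_iff_mem.2 ⟨u, hu⟩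
  obtain ⟨g1, a1, y, sy, o, v1, hg1, ha1, haD, hy, hsy, hdec, hor⟩ :=
    ev_decisionCode hnt hgd hd hcw
  obtain ⟨g2, l, hg2, hl, hle⟩ := allIn_elim hgl (x := c) (a := 0) hcw
  have ho : o = 1 := by simpa [hdec, eq_comm] using hc1
  have hc' : ev searchCode [q] = Part.some c := Part.eq_some_iff.2 hc
  refine ⟨c, a1, l, y, sy, ?_, haD, hle, hy, hsy, ?_⟩
  · simp [exceptionCode, hsep, ← hq, hc', hg1, ha1, hg2, hl]
  · rcases hor with h | h
    · omega
    · exact h.2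

/-! ### The limit of the net -/

/-- Variables of this and the following programs: realizer of `I ξ U`, realizer of `U ∈ Q`, `U`,
limit of the net along the sequence, convergence of sequences, sequence realizer, sequence,
separability, net realizer, net, reflexivity, existence of regular pairs. -/
noncomputable def regularCode (U q i : Code) : Code :=
  ap (ap (ap (ap (ap (var 11) (fs (var 3))) (fs (sn (var 3)))) U) q) i

/-- The pairs `⟨U;V⟩`, `⟨V;W⟩`, `⟨W;X⟩`, each built on the neighbourhood produced by the one before.
-/
noncomputable def regularCode₁ : Code := regularCode (var 2) (var 1) (var 0)

noncomputable def regularCode₂ : Code :=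
  regularCode (fs regularCode₁) (fs (sn regularCode₁)) (fs (sn (sn regularCode₁)))

noncomputable def regularCode₃ : Code :=
  regularCode (fs regularCode₂) (fs (sn regularCode₂)) (fs (sn (sn regularCode₂)))

noncomputable def diagonalCode : Code := exists_diagonal.choose

/-- Variables: `n`, reflexivity, sequence realizer, sequence. -/
noncomputable def termCode : Code :=
  pr (ap (var 3) (var 0)) (pr (ap (var 2) (var 0))
    (ap (ap (var 1) (ap (var 3) (var 0))) (ap (var 2) (var 0))))

/-- The step `m` at which the diagonal sequence may leave `z`; its three arguments are `z` with its
realizers, the modulus for `W`, and the search for an exception to `⟨V;W⟩`. -/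
noncomputable def stageCode : Code :=
  sub diagonalCode [sub (lam termCode) [var 10, var 5, var 6],
    sub (lam modulusCode) [fs (sn regularCode₂), fs regularCode₂, sn (sn (sn regularCode₃)), var 4],
    sub (lam exceptionCode) [sn (sn (sn regularCode₂)), var 9, var 8, var 7, var 5, var 6]]

/-- Variables: realizer of `β ≤ β'`, realizer of `β' ∈ D`, `β'`, net realizer, net, regular pair. -/
noncomputable def tailCode : Code :=
  sn (ap (ap (var 5) (ap (var 4) (var 2))) (ap (ap (var 3) (var 2)) (var 1)))

noncomputable def stageSeparationCode : Code :=
  ap (ap (var 7) (ap (var 6) stageCode)) (ap (var 5) stageCode)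

noncomputable def limitCode : Code :=
  pr (fs stageSeparationCode) (pr (fs (sn stageSeparationCode))
    (sub (lam (lam (lam tailCode))) [var 8, var 9, sn (sn (sn regularCode₁))]))

theorem hasRegularPairs_elim {S Q : CSet} {I : CRel} {rg x sx U q i : ℕ}
    (hrg : rg ∈ hasRegularPairs S Q I) (hx : sx ∈ S x) (hq : q ∈ Q U) (hi : i ∈ I x U) :
    ∃ V qV iV d, qV ∈ Q V ∧ iV ∈ I x V ∧ d ∈ regularPair S Q I U V ∧
      ∀ (e : ℕ) (l : List ℕ) (cU cq ci : Code),
        l.getD 11 0 = rg → l.getD 3 0 = Nat.pair x (Nat.pair sx e) →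
        ev cU l = Part.some U → ev cq l = Part.some q → ev ci l = Part.some i →
        ev (regularCode cU cq ci) l =
          Part.some (Nat.pair V (Nat.pair qV (Nat.pair iV d))) := by
  obtain ⟨g1, g2, h1, h2, h3⟩ := allIn_elim hrg hx
  obtain ⟨g3, g4, h4, h5, h6⟩ := allIn_elim h3 hq
  obtain ⟨r, hr, h7⟩ := impl_elim h6 hi
  obtain ⟨V, qV, _, rfl, hqV, h8⟩ := exIn_elim h7
  obtain ⟨iV, d, rfl, hiV, hd⟩ := conj_elim h8
  refine ⟨V, qV, iV, d, hqV, hiV, hd, fun e l cU cq ci hl hl' hU hq hi => ?_⟩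
  simp only [regularCode, ev_ap, ev_fs, ev_sn, ev_var, hl, hl', hU, hq, hi, Part.bind_some,
    Nat.unpair_pair, h1, h2, h4, h5, hr]

/-- If no index in a generated set is decided negatively by the regular pair `⟨V; W⟩`, then an
adherent point of the points with indices in the set is an adherent point of `V`. -/
theorem exists_mem_adherent_of_forall_decision {S Q : CSet} {I : CRel} {D : CSet}
    {f nt w gd V W d y a : ℕ} (hnt : nt ∈ isNet S D f) (hgd : gd ∈ allIn (genSet w) D)
    (hd : d ∈ regularPair S Q I V W)
    (hno : ∀ γ v, (app w γ).Dom →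
      ev decisionCode [γ, w, gd, nt, f, d] ≠ Part.some (Nat.pair 1 v))
    (ha : a ∈ adherent S Q I (imageSet f (genSet w)) y) :
    ∃ b, b ∈ adherent S Q I (fun x => I x V) y := by
  let r : Code := ap (ap (ap (var 8) (var 2)) (var 1)) (var 0)
  let c : Code := pr (fs r) (pr (fs (sn r)) (pr
    (sn (sub decisionCode [fs (fs (sn (sn r))), var 3, var 4, var 5, var 6, var 7]))
    (sn (sn (sn r)))))
  refine ⟨clo (lam (lam c)) [w, gd, nt, f, d, a],
    clo_mem_allIn fun U q hq => ⟨clo c _, by simp; rfl, clo_mem_impl fun i hi => ?_⟩⟩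
  obtain ⟨g1, g2, h1, h2, h3⟩ := allIn_elim ha hq
  obtain ⟨_, h4, h5⟩ := impl_elim h3 hi
  obtain ⟨x, sx, _, rfl, hsx, h6⟩ := exIn_elim h5
  obtain ⟨im, k, rfl, him, hk⟩ := conj_elim h6
  obtain ⟨γ, k1, k2, rfl, hγ, h7⟩ := exIn_elim him
  obtain ⟨x', hx', rfl⟩ := val_elim h7
  obtain ⟨-, -, y', sy, o, v, -, -, -, hy, hsy, hdec, hor⟩ := ev_decisionCode hnt hgd hd hγ
  rw [hx', Part.some_inj] at hy
  subst hy
  have hv : v ∈ I x V := by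
    rcases hor with h | h
    · exact h.2
    · exact absurd (h.1 ▸ hdec) (hno γ v hγ)
  have hr : ev r [i, q, U, w, gd, nt, f, d, a] = Part.some (Nat.pair x (Nat.pair sx
      (Nat.pair (Nat.pair γ (Nat.pair k1 k2)) k))) := by
    simp [r, h1, h2, h4]
  exact ⟨Nat.pair x (Nat.pair sx (Nat.pair v k)), by simp [c, hr, hdec],
    pair_mem_exIn hsx (pair_mem_conj hv hk)⟩

theorem ev_limitCode {S Q : CSet} {I : CRel} {D : CSet} {le : CRel}
    {i q U ξ sξ e cv sz z sp nt f rf rg : ℕ}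
    (hrg : rg ∈ hasRegularPairs S Q I) (hrf : rf ∈ allIn D fun a => le a a)
    (hnt : nt ∈ isNet S D f) (hsp : sp ∈ isSeparableNet S Q I D le f) (hsz : sz ∈ isSeq D z)
    (hcv : cv ∈ all fun x => isSeq D x ⇒ᵣ isRegularSeq le z x ⇒ᵣ
      seqConverges S Q I fun n => (app x n).bind fun a => app f a)
    (hξ : sξ ∈ S ξ) (he : e ∈ isLimit Q I (fun n => (app z n).bind fun a => app f a) ξ)
    (hq : q ∈ Q U) (hi : i ∈ I ξ U) :
    ∃ b, ev limitCode [i, q, U, Nat.pair ξ (Nat.pair sξ e), cv, sz, z, sp, nt, f, rf, rg] =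
        Part.some b ∧
      b ∈ exIn D fun a => allIn D fun b => le a b ⇒ᵣ val (app f b) fun y => I y U := by
  obtain ⟨l, hl⟩ : ∃ l, l = [i, q, U, Nat.pair ξ (Nat.pair sξ e), cv, sz, z, sp, nt, f, rf, rg] :=
    ⟨_, rfl⟩
  rw [← hl]
  have hl11 : l.getD 11 0 = rg := by simp [hl]
  have hl3 : l.getD 3 0 = Nat.pair ξ (Nat.pair sξ e) := by simp [hl]
  -- the three regular pairs
  obtain ⟨V, qV, iV, d₁, hqV, hiV, hd₁, hr₁⟩ := hasRegularPairs_elim hrg hξ hq hi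
  replace hr₁ : ev regularCode₁ l = _ :=
    hr₁ e l _ _ _ hl11 hl3 (by simp [hl]) (by simp [hl]) (by simp [hl])
  obtain ⟨W, qW, iW, d₂, hqW, hiW, hd₂, hr₂⟩ := hasRegularPairs_elim hrg hξ hqV hiV
  replace hr₂ : ev regularCode₂ l = _ :=
    hr₂ e l _ _ _ hl11 hl3 (by simp [hr₁]) (by simp [hr₁]) (by simp [hr₁])
  obtain ⟨X, qX, iX, d₃, hqX, hiX, hd₃, hr₃⟩ := hasRegularPairs_elim hrg hξ hqW hiW
  replace hr₃ : ev regularCode₃ l = _ :=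
    hr₃ e l _ _ _ hl11 hl3 (by simp [hr₂]) (by simp [hr₂]) (by simp [hr₂])
  -- the terms of the sequence and their points
  have hz : ∀ n, ∃ a da, app z n = Part.some a ∧ app sz n = Part.some da ∧ da ∈ D a := by
    intro n
    obtain ⟨da, hda, h⟩ := all_elim hsz n
    obtain ⟨a, ha, h⟩ := val_elim h
    exact ⟨a, da, ha, hda, h⟩
  choose a da ha hda haD using hz
  have hpt : ∀ n, ∃ g sy y, app nt (a n) = Part.some g ∧ app g (da n) = Part.some sy ∧
      app f (a n) = Part.some y ∧ sy ∈ S y := by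
    intro n
    obtain ⟨g, sy, hg, hsy, h⟩ := allIn_elim hnt (haD n)
    obtain ⟨y, hy, h⟩ := val_elim h
    exact ⟨g, sy, y, hg, hsy, hy, h⟩
  choose g sy y hg hsy hy hsyS using hpt
  have hre : ∀ n, ∃ g r, app rf (a n) = Part.some g ∧ app g (da n) = Part.some r ∧
      r ∈ le (a n) (a n) := fun n => allIn_elim (P := fun a => le a a) hrf (haD n)
  choose g' r hg' hr hrle using hre
  obtain ⟨zz, hzz⟩ : ∃ zz, zz = clo termCode [rf, sz, z] := ⟨_, rfl⟩
  have hzz_app : ∀ n, app zz n = Part.some (Nat.pair (a n) (Nat.pair (da n) (r n))) := fun n => by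
    simp [hzz, termCode, ha, hda, hg', hr]
  -- Stated for any eventual agreement with `f ∘ z`, to cover both the unmodified sequence (`K = 0`)
  -- and the one changed at `m` (`K = m + 1`).
  have hadh : ∀ (t : ℕ → Part ℕ) (K y' e' : ℕ), (∀ n, K ≤ n → t n = Part.some (y n)) →
      e' ∈ isLimit Q I t y' → ∃ b, b ∈ adherent S Q I (fun y => I y X) y' := by
    intro t K y' e' ht he'
    refine exists_mem_adherent_of_isLimit (y := y) (sy := sy) (K := K)
      (g := clo (pr (ap (var 1) (ap (var 3) (var 0)))
        (ap (ap (var 2) (ap (var 3) (var 0))) (ap (var 4) (var 0)))) [f, nt, z, sz])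
      he hqX hiX (fun n => ?_) hsyS (fun n => ?_) ht he'
    · simp [ha, hy, hg, hda, hsy]
    · simp [ha, hy]
  -- the stage
  obtain ⟨rr, hrr⟩ : ∃ rr, rr = clo modulusCode [qW, W, d₃, cv] := ⟨_, rfl⟩
  obtain ⟨bb, hbb⟩ : ∃ bb, bb = clo exceptionCode [d₂, f, nt, sp, sz, z] := ⟨_, rfl⟩
  obtain ⟨m, hm, s, N, hN, hNm, hs⟩ := exists_diagonal.choose_spec zz rr bb (by
    -- Here `s` has the same values as `z` but an arbitrary number; the modulus must stop on it.
    intro s hs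
    obtain ⟨N, hN, -⟩ := ev_modulusCode (s := s) (x := a) (dx := da) (lx := r) hcv hqW hd₃
      (fun n => by rw [hs, hzz_app]) haD (fun n => by rw [ha, val_some]; exact hrle n)
      fun y' e' he' => hadh _ 0 y' e' (fun n _ => hy n) he'
    rw [hrr, app_clo, hN]
    trivial)
  have hstage : ev stageCode l = Part.some m := by
    have hm' : ev diagonalCode [zz, rr, bb] = Part.some m := Part.eq_some_iff.2 hm
    rw [hzz, hrr, hbb] at hm'
    simp only [stageCode, ev_sub, evs_cons, evs_nil, ev_lam, ev_fs, ev_sn, ev_var, hr₂, hr₃,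
      Part.bind_some, Nat.unpair_pair]
    simp [hl, hm']
  obtain ⟨gs, r', hgs, hr', h₁⟩ := allIn_elim hsp (haD m)
  obtain ⟨b, db, _, rfl, hdb, h₂⟩ := exIn_elim h₁
  obtain ⟨lb, _, rfl, hlb, h₃⟩ := conj_elim h₂
  obtain ⟨w, _, rfl, h₄⟩ := ex_elim h₃
  obtain ⟨gd, _, rfl, hgd, h₅⟩ := conj_elim h₄
  obtain ⟨gl, ad, rfl, hgl, had⟩ := conj_elim h₅
  -- An exception would make the diagonal sequence total and regular, so its modulus would be
  -- correct and at most `m`, forcing the inserted point into `W`.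
  have hno : ∀ γ v, (app w γ).Dom →
      ev decisionCode [γ, w, gd, nt, f, d₂] ≠ Part.some (Nat.pair 1 v) := by
    intro γ v hγ hv
    obtain ⟨c, dc, lc, x, sx, hc, hdc, hlc, hx, hsx, hnot⟩ :=
      ev_exceptionCode hnt (ha m) (hda m) hgs hr' hgd hgl hd₂ hγ hv
    obtain ⟨N', hN', hmod⟩ := ev_modulusCode (s := s) (x := fun n => if n = m then c else a n)
      (dx := fun n => if n = m then dc else da n) (lx := fun n => if n = m then lc else r n)
      hcv hqW hd₃
      (fun n => by
        rw [hs]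
        split_ifs
        · rw [hbb, app_clo, hc]
        · rw [hzz_app])
      (fun n => by
        split_ifs with h
        · exact hdc
        · exact haD n)
      (fun n => by
        rw [ha, val_some]
        split_ifs with h
        · exact h ▸ hlc
        · exact hrle n)
      fun y' e' he' => hadh (fun n => app f (if n = m then c else a n)) (m + 1) y' e'
        (fun n hn => by rw [if_neg (by omega), hy]) he'
    -- The value seen by the diagonal sequence is the modulus itself, since both come from one
    -- computation on `s`.
    have hNN : N = N' := by
      rw [hrr, app_clo, hN', Part.mem_some_iff] at hN
      exact hN
    obtain ⟨x', k, hx', hk⟩ := hmod m (hNN ▸ hNm)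
    rw [if_pos rfl, hx, Part.some_inj] at hx'
    subst hx'
    obtain ⟨b, hb⟩ := exists_mem_adherent_of_mem (Q := Q) hsx hk
    exact hnot b hb
  -- the result
  have hss : ev stageSeparationCode l = Part.some (Nat.pair b (Nat.pair db (Nat.pair lb
      (Nat.pair w (Nat.pair gd (Nat.pair gl ad)))))) := by
    simp only [stageSeparationCode, ev_ap, hstage, ev_var, Part.bind_some]
    simp [hl, ha, hda, hgs, hr']
  refine ⟨Nat.pair b (Nat.pair db (clo (lam (lam tailCode)) [nt, f, d₁])), ?_, ?_⟩
  · simp only [limitCode, ev_sub, evs_cons, evs_nil, ev_lam, ev_fs, ev_sn, ev_var, ev_pr, hr₁, hss,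
      Part.bind_some, Nat.unpair_pair]
    simp [hl]
  · refine pair_mem_exIn hdb (clo_mem_allIn fun b' db' hdb' =>
      ⟨clo tailCode [db', b', nt, f, d₁], by simp, clo_mem_impl fun lb' hlb' => ?_⟩)
    obtain ⟨g1, sx, hg1, hsx, h1⟩ := allIn_elim hnt hdb'
    obtain ⟨x, hx, hsxS⟩ := val_elim h1
    obtain ⟨g2, g3, -, -, h2⟩ := allIn_elim had hdb'
    obtain ⟨k, -, h3⟩ := impl_elim h2 hlb'
    rw [hx, val_some] at h3
    obtain ⟨k', hk'⟩ := exists_mem_adherent_of_forall_decision hnt hgd hd₂ hno h3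
    obtain ⟨g4, o, v, hg4, hv, hor⟩ := regularPair_elim hd₁ hsxS
    refine ⟨v, by simp [tailCode, hx, hg1, hsx, hg4, hv], ?_⟩
    rw [hx, val_some]
    rcases hor with h | h
    · exact h.2
    · exact absurd hk' (h.2 k')

/-- Variables: convergence of sequences, sequence realizer, sequence, separability, net realizer,
net, reflexivity, existence of regular pairs. -/
noncomputable def alongCode : Code :=
  ap (ap (ap (var 0) (var 2)) (var 1))
    (sub (lam (sn (sn termCode))) [var 6, var 1, var 2])

/-- The limit along `z` is computed once and put at the head of the environment, so all
neighbourhoods refer to the same point. -/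
noncomputable def netLimitCode : Code :=
  sub (pr (fs (var 0)) (pr (fs (sn (var 0))) (lam (lam (lam limitCode)))))
    [alongCode, var 0, var 1, var 2, var 3, var 4, var 5, var 6, var 7]

theorem ev_netLimitCode {S Q : CSet} {I : CRel} {D : CSet} {le : CRel}
    {cv sz z sp nt f rf rg : ℕ}
    (hrg : rg ∈ hasRegularPairs S Q I) (hrf : rf ∈ allIn D fun a => le a a)
    (hnt : nt ∈ isNet S D f) (hsp : sp ∈ isSeparableNet S Q I D le f) (hsz : sz ∈ isSeq D z)
    (hcv : cv ∈ all fun x => isSeq D x ⇒ᵣ isRegularSeq le z x ⇒ᵣ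
      seqConverges S Q I fun n => (app x n).bind fun a => app f a) :
    ∃ b, ev netLimitCode [cv, sz, z, sp, nt, f, rf, rg] = Part.some b ∧
      b ∈ netHasLimit S Q I D le f := by
  have hreg : clo (sn (sn termCode)) [rf, sz, z] ∈ isRegularSeq le z z := by
    refine clo_mem_all fun n => ?_
    obtain ⟨da, hda, h⟩ := all_elim hsz n
    obtain ⟨a, ha, h⟩ := val_elim h
    obtain ⟨g, r, hg, hr, hle⟩ := allIn_elim hrf h
    exact ⟨r, by simp [termCode, ha, hda, hg, hr], by simpa [ha, val_some] using hle⟩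
  obtain ⟨g1, hg1, h1⟩ := all_elim hcv z
  obtain ⟨g2, hg2, h2⟩ := impl_elim h1 hsz
  obtain ⟨r, hr, h3⟩ := impl_elim h2 hreg
  obtain ⟨ξ, sξ, e, rfl, hξ, he⟩ := exIn_elim h3
  have ha : ev alongCode [cv, sz, z, sp, nt, f, rf, rg] =
      Part.some (Nat.pair ξ (Nat.pair sξ e)) := by
    simp [alongCode, hg1, hg2, hr]
  refine ⟨Nat.pair ξ (Nat.pair sξ (clo (lam (lam limitCode))
    [Nat.pair ξ (Nat.pair sξ e), cv, sz, z, sp, nt, f, rf, rg])), by simp [netLimitCode, ha], ?_⟩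
  refine pair_mem_exIn hξ (clo_mem_allIn fun U q hq => ⟨clo limitCode _, by simp; rfl,
    clo_mem_impl fun i hi => ?_⟩)
  exact ev_limitCode hrg hrf hnt hsp hsz hcv hξ he hq hi

noncomputable def mainCode : Code :=
  sub netLimitCode [var 0, var 3, var 4, var 5, var 6, var 7, fs (var 8), var 9]

end Constructive

theorem mainTheorem1 :
    ∃ e : ℕ, ∀ (S Q : CSet) (I : CRel) (D : CSet) (le : CRel),
      e ∈ (isTopSpace S Q I ⇒ᵣ hasRegularPairs S Q I ⇒ᵣ isDirected D le ⇒ᵣ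
        all fun f => isNet S D f ⇒ᵣ isSeparableNet S Q I D le f ⇒ᵣ
        all fun z => isSeq D z ⇒ᵣ isNondecreasing le z ⇒ᵣ isCofinal D le z ⇒ᵣ
          (all fun x => isSeq D x ⇒ᵣ isRegularSeq le z x ⇒ᵣ
            seqConverges S Q I fun n => (app x n).bind fun a => app f a) ⇒ᵣ
          netHasLimit S Q I D le f) := by
  refine ⟨clo (lam (lam (lam (lam (lam (lam (lam (lam (lam (lam mainCode)))))))))) [],
    fun S Q I D le => ?_⟩
  refine clo_mem_impl fun top _ => ⟨clo _ _, ev_lam _ _, ?_⟩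
  refine clo_mem_impl fun rg hrg => ⟨clo _ _, ev_lam _ _, ?_⟩
  refine clo_mem_impl fun dir hdir => ⟨clo _ _, ev_lam _ _, ?_⟩
  refine clo_mem_all fun f => ⟨clo _ _, ev_lam _ _, ?_⟩
  refine clo_mem_impl fun nt hnt => ⟨clo _ _, ev_lam _ _, ?_⟩
  refine clo_mem_impl fun sp hsp => ⟨clo _ _, ev_lam _ _, ?_⟩
  refine clo_mem_all fun z => ⟨clo _ _, ev_lam _ _, ?_⟩
  refine clo_mem_impl fun sz hsz => ⟨clo _ _, ev_lam _ _, ?_⟩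
  refine clo_mem_impl fun nd _ => ⟨clo _ _, ev_lam _ _, ?_⟩
  refine clo_mem_impl fun cf _ => ⟨clo _ _, ev_lam _ _, ?_⟩
  refine clo_mem_impl fun cv hcv => ?_
  obtain ⟨b, hb, h⟩ := ev_netLimitCode hrg hdir.1 hnt hsp hsz hcv
  exact ⟨b, by simp [mainCode, hb], h⟩
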